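/- Let $\mathcal{C}$ be a small category and $J$ a Grothendieck topology on $\mathcal{C}$; call a presieve covering if the sieve it generates is $J$-covering. Suppose that: (1) (*The site has functorial coamalgamation.*) There exist a functor $\mathsf{coamalg}$ from the category of cospans in $\mathcal{C}$ to $\mathcal{C}$ and a natural transformation from $\Delta\circ\mathsf{coamalg}$ to the identity, where $\Delta$ sends an object to the constant cospan on it (so each cospan is completed to a commutative square, the coamalgamation square, naturally in the cospan, with no universal property required), such that for every $J$-covering presieve $\{f_i : C_i \to C\}_{i\in I}$ and every morphism $h : D \to C$ the sides $g_i : D_i \to D$ opposite to $f_i$ in the coamalgamation squares of $(h, f_i)$, where $D_i=\mathsf{coamalg}(D \xrightarrow{h} C \xleftarrow{f_i} C_i)$, form a $J$-covering presieve $\{g_i : D_i \to D\}_{i\in I}$. (2) Every $J$-covering sieve on an object $C$ contains a $J$-covering sieve $S'$ on $C$ which, viewed as a full subcategory of the slice category $\mathcal{C}/C$, has a finite (not necessarily full) subcategory (finitely many objects and morphisms) whose inclusion into $S'$ is a final functor. Then the topos $\mathrm{Sh}(\mathcal{C},J)$ has enough points: there is a set of points (geometric morphisms $p : \mathrm{Set}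 \to \mathrm{Sh}(\mathcal{C},J)$) whose inverse image functors $p^*$ are jointly conservative. -/

import Mathlib

open CategoryTheory Limits Opposite

universe w v u v₁ u₁ v₂ u₂

/-- A geometric morphism `F ⟶ E`: a direct image functor `F ⥤ E` together with a left adjoint
(the inverse image functor) that preserves finite limits. -/
structure GeometricMorphism (F : Type u₁) [Category.{v₁} F] (E : Type u₂) [Category.{v₂} E] where
  directImage : F ⥤ E
  inverseImage : E ⥤ F
  adj : inverseImage ⊣ directImage
  lex : PreservesFiniteLimits inverseImage

/-- A point of a topos `E` is a geometric morphism `Set ⟶ E`. -/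
abbrev ToposPoint (E : Type u₂) [Category.{v₂} E] :=
  GeometricMorphism (Type w) E

/-- A topos `E` has enough points if there is a small family of points of `E` whose
inverse image functors are jointly conservative. -/
def ToposHasEnoughPoints (E : Type u₂) [Category.{v₂} E] : Prop :=
  ∃ (K : Type w) (p : K → ToposPoint.{w} E),
    JointlyReflectIsomorphisms (fun k : K => (p k).inverseImage)

/-- A functorial amalgamation on `C`: a functor from the category of spans in `C` to `C`, with a
natural transformation from the identity to the composite of this functor with the diagonal
functor; that is, a natural completion of each span to a commutative square. -/
structure FunctorialAmalgamation (C : Type u) [Category.{v} C] where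
  amalg : (WalkingSpan ⥤ C) ⥤ C
  ι : 𝟭 (WalkingSpan ⥤ C) ⟶ amalg ⋙ Functor.const WalkingSpan

/-- A functorial coamalgamation on `C` is a functorial amalgamation on `Cᵒᵖ`. -/
abbrev FunctorialCoamalgamation (C : Type u) [Category.{v} C] :=
  FunctorialAmalgamation Cᵒᵖ

namespace FunctorialCoamalgamation

variable {C : Type u} [Category.{v} C] (a : FunctorialCoamalgamation C)

/-- The corner of the coamalgamation square of the cospan `h : Y ⟶ X ⟵ Z : f`. -/
def corner {X Y Z : C} (h : Y ⟶ X) (f : Z ⟶ X) : C :=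
  (a.amalg.obj (span h.op f.op)).unop

/-- The side of the coamalgamation square of `h : Y ⟶ X ⟵ Z : f` opposite to `f`. -/
def fst {X Y Z : C} (h : Y ⟶ X) (f : Z ⟶ X) : a.corner h f ⟶ Y :=
  ((a.ι.app (span h.op f.op)).app WalkingSpan.left).unop

/-- The side of the coamalgamation square of `h : Y ⟶ X ⟵ Z : f` opposite to `h`. -/
def snd {X Y Z : C} (h : Y ⟶ X) (f : Z ⟶ X) : a.corner h f ⟶ Z :=
  ((a.ι.app (span h.op f.op)).app WalkingSpan.right).unop

/-- The presieve on `Y` consisting of the sides opposite to `f` of the coamalgamation squares of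
`h : Y ⟶ X` and `f`, where `f` runs through the presieve `R` on `X`. -/
inductive coamalgArrows {X Y : C} (h : Y ⟶ X) (R : Presieve X) : Presieve Y
  | mk (Z : C) (f : Z ⟶ X) (hf : R f) : coamalgArrows h R (a.fst h f)

end FunctorialCoamalgamation

/-- The site `(C, J)` has functorial coamalgamation: `C` has a functorial coamalgamation whose
squares send every covering presieve on `X`, along any `h : Y ⟶ X`, to a covering presieve
on `Y`. (A presieve is covering if the sieve it generates is.) -/
def SiteHasFunctorialCoamalgamation {C : Type u} [Category.{v} C]
    (J : GrothendieckTopology C) : Prop :=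
  ∃ a : FunctorialCoamalgamation C,
    ∀ ⦃X : C⦄ (R : Presieve X), Sieve.generate R ∈ J X →
      ∀ ⦃Y : C⦄ (h : Y ⟶ X), Sieve.generate (a.coamalgArrows h R) ∈ J Y

/-- The sieve `S` on `X`, regarded as the full subcategory of `C/X` on its elements, has a finite
(not necessarily full) subcategory `D` such that the inclusion of `D` in `S` is a final functor.
Subcategories are given by functors that are faithful and injective on objects. -/
def HasFiniteFinalSubdiagram {C : Type u} [Category.{v} C] {X : C} (S : Sieve X) : Prop :=
  ∃ (D : Type) (_ : SmallCategory D) (_ : FinCategory D) (i : D ⥤ S.arrows.category),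
    i.Faithful ∧ Function.Injective i.obj ∧ i.Final

/-! A point of the site is a flat functor `F : C ⥤ Type u` sending covering sieves to jointly
surjective families. A set of points is conservative once every non-covering sieve `S` on `X` admits
a point with some `x : F.obj X` outside the image of `S`. As in Deligne's theorem, such an `F` is
built from `coyoneda` and `𝟙 X` by forcing. To put `α : F.obj A` into a covering sieve generated by
finitely many `f i`, replace `F` by the functor pro-represented by the coamalgamation corners along
one `f i`. If every `i` spoiled avoidance of `S`, cofilteredness would give one stage where all do;
the corners cover that stage, so `S` would already be covering there
(`exists_isFlatAvoiding_baseChange`). Avoidance passes to filtered colimits, so transfinite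
iteration treats all pairs of an element and a covering sieve, and ω repetitions treat the elements
created on the way. -/

/-! ### Filtered colimits of flat functors. -/

namespace CategoryTheory.FunctorToTypes

variable {C : Type u} [SmallCategory C] {K : Type w} [Category.{v} K]
  {G : K ⥤ C ⥤ Type u} {c : Cocone G}

lemma colimit_ι_map_apply (c : Cocone G) {k l : K} (e : k ⟶ l) {Y : C} (y : (G.obj k).obj Y) :
    (c.ι.app l).app Y ((G.map e).app Y y) = (c.ι.app k).app Y y :=
  ConcreteCategory.congr_hom (NatTrans.congr_app (c.w e) Y) y

variable [HasColimitsOfShape K (Type u)]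

/-- A colimit cocone of functors to types, evaluated at an object. -/
noncomputable def isColimitEvaluation (hc : IsColimit c) (Y : C) :
    IsColimit (((evaluation C (Type u)).obj Y).mapCocone c) :=
  isColimitOfPreserves _ hc

lemma colimit_exists_rep (hc : IsColimit c) {Y : C} (y : c.pt.obj Y) :
    ∃ (k : K) (y' : (G.obj k).obj Y), (c.ι.app k).app Y y' = y :=
  Types.jointly_surjective_of_isColimit (isColimitEvaluation hc Y) y

variable [IsFiltered K]

lemma colimit_exists_of_eq (hc : IsColimit c) {Y : C} {k : K} {y y' : (G.obj k).obj Y}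
    (h : (c.ι.app k).app Y y = (c.ι.app k).app Y y') :
    ∃ (l : K) (e : k ⟶ l), (G.map e).app Y y = (G.map e).app Y y' := by
  obtain ⟨l, f, g, hfg⟩ := (Types.FilteredColimit.isColimit_eq_iff _
    (isColimitEvaluation hc Y)).1 h
  -- The criterion gives two parallel transition maps; coequalizing them leaves one.
  refine ⟨_, f ≫ IsFiltered.coeqHom f g, ?_⟩
  nth_rw 2 [IsFiltered.coeq_condition]
  simp only [Functor.map_comp, NatTrans.comp_app, ConcreteCategory.comp_apply]
  exact congrArg _ hfg

/-- Functors whose category of elements is cofiltered are stable under filtered colimits. -/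
lemma isCofiltered_elements_of_isColimit (hc : IsColimit c)
    (hG : ∀ k, IsCofiltered (G.obj k).Elements) : IsCofiltered c.pt.Elements := by
  have cone_objs (X Y : c.pt.Elements) : ∃ (W : _) (_ : W ⟶ X) (_ : W ⟶ Y), True := by
    obtain ⟨X, x⟩ := X
    obtain ⟨Y, y⟩ := Y
    obtain ⟨k, x, rfl⟩ := colimit_exists_rep hc x
    obtain ⟨l, y, rfl⟩ := colimit_exists_rep hc y
    have := hG (IsFiltered.max k l)
    obtain ⟨W, f, g, -⟩ := IsCofilteredOrEmpty.cone_objs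
      ((G.obj (IsFiltered.max k l)).elementsMk X ((G.map (IsFiltered.leftToMax k l)).app X x))
      ((G.obj (IsFiltered.max k l)).elementsMk Y ((G.map (IsFiltered.rightToMax k l)).app Y y))
    refine ⟨⟨W.1, (c.ι.app _).app _ W.2⟩, CategoryOfElements.homMk _ _ f.1 ?_,
      CategoryOfElements.homMk _ _ g.1 ?_, trivial⟩
    · rw [← NatTrans.naturality_apply, f.2, colimit_ι_map_apply]
    · rw [← NatTrans.naturality_apply, g.2, colimit_ι_map_apply]
  have cone_maps {X Y : c.pt.Elements} (f g : X ⟶ Y) : ∃ (W : _) (h : W ⟶ X), h ≫ f = h ≫ g := by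
    obtain ⟨X, x⟩ := X
    obtain ⟨Y, y⟩ := Y
    obtain ⟨f, hf⟩ := f
    obtain ⟨g, hg⟩ := g
    obtain ⟨k, x, rfl⟩ := colimit_exists_rep hc x
    dsimp at f g hf hg
    obtain ⟨l, e, he⟩ := colimit_exists_of_eq hc (y := (G.obj k).map f x)
      (y' := (G.obj k).map g x) (by
        rw [NatTrans.naturality_apply, NatTrans.naturality_apply]
        exact hf.trans hg.symm)
    have := hG l
    obtain ⟨W, h, hh⟩ := IsCofilteredOrEmpty.cone_maps
      (CategoryOfElements.homMk ((G.obj l).elementsMk X ((G.map e).app X x))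
        ((G.obj l).elementsMk Y ((G.map e).app Y ((G.obj k).map f x))) f
        (NatTrans.naturality_apply (G.map e) f x).symm)
      (CategoryOfElements.homMk _ _ g
        ((NatTrans.naturality_apply (G.map e) g x).symm.trans he.symm))
    refine ⟨⟨W.1, (c.ι.app _).app _ W.2⟩, CategoryOfElements.homMk _ _ h.1 ?_, ?_⟩
    · rw [← NatTrans.naturality_apply, h.2, colimit_ι_map_apply]
    · exact Subtype.ext (congrArg (fun q => q.1) hh)
  have : Nonempty c.pt.Elements := by
    obtain ⟨k⟩ := IsFiltered.nonempty (C := K)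
    have := hG k
    obtain ⟨Y⟩ := IsCofiltered.nonempty (C := (G.obj k).Elements)
    exact ⟨⟨Y.1, (c.ι.app k).app _ Y.2⟩⟩
  exact { cone_objs := cone_objs, cone_maps := fun _ _ => cone_maps }

/-- Representable functors have a cofiltered category of elements. -/
lemma isCofiltered_elements_coyoneda (X : C) : IsCofiltered (coyoneda.obj (op X)).Elements := by
  let t (Y : (coyoneda.obj (op X)).Elements) :
      (coyoneda.obj (op X)).elementsMk X (𝟙 X) ⟶ Y :=
    CategoryOfElements.homMk _ _ Y.2 (Category.id_comp _)
  have : Nonempty (coyoneda.obj (op X)).Elements := ⟨⟨X, 𝟙 X⟩⟩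
  exact
    { cone_objs := fun Y Z => ⟨_, t Y, t Z, trivial⟩
      cone_maps := fun Y Z f g => ⟨_, t Y, Subtype.ext (f.2.trans g.2.symm)⟩ }

end CategoryTheory.FunctorToTypes

/-! ### Functoriality of the corners. -/

namespace FunctorialCoamalgamation

variable {C : Type u} [Category.{v} C] (a : FunctorialCoamalgamation C)

/-- The transformation of spans in `Cᵒᵖ` induced by a morphism in `Over A`. -/
def spanMap {A Z : C} (f : Z ⟶ A) {Y Y' : Over A} (g : Y ⟶ Y') :
    span Y'.hom.op f.op ⟶ span Y.hom.op f.op :=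
  spanHomMk (𝟙 _) g.left.op (𝟙 _) (by simp [← op_comp]) (by simp)

/-- The corner of the coamalgamation square of `f` and `Y.hom`, as a functor of `Y : Over A`. -/
def cornerFunctor {A Z : C} (f : Z ⟶ A) : Over A ⥤ C where
  obj Y := a.corner Y.hom f
  map g := (a.amalg.map (spanMap f g)).unop
  map_id Y := by
    have : spanMap f (𝟙 Y) = 𝟙 _ := by ext (_ | _ | _) <;> rfl
    exact congrArg Quiver.Hom.unop ((congrArg a.amalg.map this).trans (a.amalg.map_id _))
  map_comp g h := by
    have : spanMap f (g ≫ h) = spanMap f h ≫ spanMap f g := by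
      ext (_ | _ | _)
      exacts [(Category.id_comp _).symm, rfl, (Category.id_comp _).symm]
    exact congrArg Quiver.Hom.unop ((congrArg a.amalg.map this).trans (a.amalg.map_comp _ _))

lemma cornerFunctor_map_fst {A Z : C} (f : Z ⟶ A) {Y Y' : Over A} (g : Y ⟶ Y') :
    (a.cornerFunctor f).map g ≫ a.fst Y'.hom f = a.fst Y.hom f ≫ g.left := by
  have := NatTrans.congr_app (a.ι.naturality (spanMap f g)) WalkingSpan.left
  exact (congrArg Quiver.Hom.unop this).symm

lemma fst_comp {Y A Z : C} (h : Y ⟶ A) (f : Z ⟶ A) : a.fst h f ≫ h = a.snd h f ≫ f := by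
  have h₁ := (a.ι.app (span h.op f.op)).naturality WalkingSpan.Hom.fst
  have h₂ := (a.ι.app (span h.op f.op)).naturality WalkingSpan.Hom.snd
  exact congrArg Quiver.Hom.unop (h₁.trans h₂.symm)

end FunctorialCoamalgamation

/-! ### Flat functors avoiding a sieve. -/

section

variable {C : Type u} [SmallCategory C] (J : GrothendieckTopology C) {X : C} (S : Sieve X)

/-- The functor `F` is flat, and its element `x` does not belong to the sieve `S`, even locally:
whenever `x` is the image of `y : F.obj Y` by `h : Y ⟶ X`, the pullback of `S` along `h` is not
a covering sieve. -/
structure IsFlatAvoiding (F : C ⥤ Type u) (x : F.obj X) : Prop where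
  isCofiltered : IsCofiltered F.Elements
  notMem {Y : C} (h : Y ⟶ X) (y : F.obj Y) (hy : F.map h y = x) : S.pullback h ∉ J Y

variable {J S}

/-- A preimage of `x'` in the colimit is already a preimage of some `x l` at a stage `l`. -/
lemma IsFlatAvoiding.of_isColimit {K : Type w} [Category.{v} K] [HasColimitsOfShape K (Type u)]
    [IsFiltered K] {G : K ⥤ C ⥤ Type u} {c : Cocone G} (hc : IsColimit c) {x : ∀ k, (G.obj k).obj X}
    (hx : ∀ {k l} (e : k ⟶ l), (G.map e).app X (x k) = x l)
    {x' : c.pt.obj X} (hx' : ∀ k, (c.ι.app k).app X (x k) = x')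
    (hG : ∀ k, IsFlatAvoiding J S (G.obj k) (x k)) : IsFlatAvoiding J S c.pt x' where
  isCofiltered := FunctorToTypes.isCofiltered_elements_of_isColimit hc
    fun k => (hG k).isCofiltered
  notMem {Y} h y hy := by
    obtain ⟨k, y, rfl⟩ := FunctorToTypes.colimit_exists_rep hc y
    obtain ⟨l, e, he⟩ := FunctorToTypes.colimit_exists_of_eq hc (k := k)
      (y := (G.obj k).map h y) (y' := x k)
      ((NatTrans.naturality_apply (c.ι.app k) h y).trans (hy.trans (hx' k).symm))
    refine (hG l).notMem h ((G.map e).app Y y) ?_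
    rw [← NatTrans.naturality_apply, he, hx]

/-- A preimage of `𝟙 X` is a section `y` of `h`, and pulling `S.pullback h` back along `y` recovers
`S`. -/
lemma IsFlatAvoiding.coyoneda (hS : S ∉ J X) :
    IsFlatAvoiding J S (coyoneda.obj (op X)) (𝟙 X) where
  isCofiltered := FunctorToTypes.isCofiltered_elements_coyoneda X
  notMem {Y} h y hy hJ := hS (by
    have := J.pullback_stable y hJ
    rwa [← Sieve.pullback_comp, show y ≫ h = 𝟙 X from hy, Sieve.pullback_id] at this)

end

/-! ### Base change of a flat functor along a morphism. -/

namespace FunctorialCoamalgamation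

variable {C : Type u} [SmallCategory C] (a : FunctorialCoamalgamation C)
  {F : C ⥤ Type u} {A Z : C} (α : F.obj A) (f : Z ⟶ A)

/-- The corners of the coamalgamation squares of `f : Z ⟶ A` and the morphisms of elements
of `F` to `α : F.obj A`. -/
def cornerDiagram : Over (F.elementsMk A α) ⥤ C :=
  Over.post (CategoryOfElements.π F) ⋙ a.cornerFunctor f

/-- The side of the coamalgamation square opposite to `f`. -/
def cornerFst (i : Over (F.elementsMk A α)) : (a.cornerDiagram α f).obj i ⟶ i.left.1 :=
  a.fst _ _

/-- The side opposite to the morphism to `A` of the coamalgamation square. -/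
def cornerSnd (i : Over (F.elementsMk A α)) : (a.cornerDiagram α f).obj i ⟶ Z :=
  a.snd _ _

lemma cornerFst_comp (i : Over (F.elementsMk A α)) :
    a.cornerFst α f i ≫ i.hom.1 = a.cornerSnd α f i ≫ f :=
  a.fst_comp _ _

lemma cornerDiagram_map_fst {i j : Over (F.elementsMk A α)} (e : i ⟶ j) :
    (a.cornerDiagram α f).map e ≫ a.cornerFst α f j = a.cornerFst α f i ≫ e.left.1 :=
  a.cornerFunctor_map_fst f ((Over.post (CategoryOfElements.π F)).map e)

/-- The functor pro-represented by `cornerDiagram`: the base change of `F` along `f`. -/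
noncomputable def baseChange : C ⥤ Type u :=
  colimit ((a.cornerDiagram α f).op ⋙ coyoneda)

/-- The element of `baseChange` given by a morphism from a corner. -/
noncomputable def baseChangeMk (i : Over (F.elementsMk A α)) {B : C}
    (k : (a.cornerDiagram α f).obj i ⟶ B) : (a.baseChange α f).obj B :=
  (colimit.ι ((a.cornerDiagram α f).op ⋙ coyoneda) (op i)).app B k

lemma map_baseChangeMk (i : Over (F.elementsMk A α)) {B B' : C}
    (k : (a.cornerDiagram α f).obj i ⟶ B) (l : B ⟶ B') :
    (a.baseChange α f).map l (a.baseChangeMk α f i k) = a.baseChangeMk α f i (k ≫ l) :=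
  (NatTrans.naturality_apply (colimit.ι ((a.cornerDiagram α f).op ⋙ coyoneda) (op i)) l k).symm

lemma baseChangeMk_map {i j : Over (F.elementsMk A α)} (e : i ⟶ j) {B : C}
    (k : (a.cornerDiagram α f).obj j ⟶ B) :
    a.baseChangeMk α f i ((a.cornerDiagram α f).map e ≫ k) = a.baseChangeMk α f j k :=
  FunctorToTypes.colimit_ι_map_apply
    (colimit.cocone ((a.cornerDiagram α f).op ⋙ coyoneda)) e.op k

lemma exists_baseChangeMk_eq {B : C} (y : (a.baseChange α f).obj B) :
    ∃ i k, a.baseChangeMk α f i k = y := by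
  obtain ⟨i, k, hk⟩ := FunctorToTypes.colimit_exists_rep
    (colimit.isColimit ((a.cornerDiagram α f).op ⋙ coyoneda)) y
  exact ⟨i.unop, k, hk⟩

variable [IsCofiltered F.Elements]

lemma isCofiltered_elements_baseChange : IsCofiltered (a.baseChange α f).Elements :=
  FunctorToTypes.isCofiltered_elements_of_isColimit
    (colimit.isColimit ((a.cornerDiagram α f).op ⋙ coyoneda))
    fun _ => FunctorToTypes.isCofiltered_elements_coyoneda _

lemma exists_of_baseChangeMk_eq {i j : Over (F.elementsMk A α)} {B : C}
    {k : (a.cornerDiagram α f).obj i ⟶ B} {l : (a.cornerDiagram α f).obj j ⟶ B}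
    (h : a.baseChangeMk α f i k = a.baseChangeMk α f j l) :
    ∃ (m : Over (F.elementsMk A α)) (d : m ⟶ i) (e : m ⟶ j),
      (a.cornerDiagram α f).map d ≫ k = (a.cornerDiagram α f).map e ≫ l := by
  obtain ⟨m, d, e, h⟩ := (Types.FilteredColimit.isColimit_eq_iff _
    (FunctorToTypes.isColimitEvaluation
      (colimit.isColimit ((a.cornerDiagram α f).op ⋙ coyoneda)) B)).1 h
  exact ⟨m.unop, d.unop, e.unop, h⟩

/-- Makes `toBaseChange` independent of choices: a bowtie in the elements of `F` refines both stages
until the two maps agree. -/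
lemma baseChangeMk_fst_eq {i j : Over (F.elementsMk A α)} {B : F.Elements}
    (k : i.left ⟶ B) (l : j.left ⟶ B) :
    a.baseChangeMk α f i (a.cornerFst α f i ≫ k.1) =
      a.baseChangeMk α f j (a.cornerFst α f j ≫ l.1) := by
  obtain ⟨s, p, q, h₁, h₂⟩ := IsCofiltered.bowtie i.hom j.hom k l
  let p' : Over.mk (p ≫ i.hom) ⟶ i := Over.homMk p
  let q' : Over.mk (p ≫ i.hom) ⟶ j := Over.homMk q h₁.symm
  rw [← a.baseChangeMk_map α f p', ← a.baseChangeMk_map α f q', ← Category.assoc,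
    ← Category.assoc, cornerDiagram_map_fst, cornerDiagram_map_fst, Category.assoc, Category.assoc]
  exact congrArg (fun t => a.baseChangeMk α f _ (a.cornerFst α f _ ≫ t))
    (congrArg (fun t => t.1) h₂)

lemma exists_over_hom (B : F.Elements) :
    ∃ i : Over (F.elementsMk A α), Nonempty (i.left ⟶ B) := by
  obtain ⟨s, p, q, -⟩ := IsCofilteredOrEmpty.cone_objs (F.elementsMk A α) B
  exact ⟨Over.mk p, ⟨q⟩⟩

/-- The canonical morphism from `F` to its base change. -/
noncomputable def toBaseChange : F ⟶ a.baseChange α f where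
  app B := TypeCat.ofHom fun b => a.baseChangeMk α f
    (exists_over_hom α (F.elementsMk B b)).choose
    (a.cornerFst α f _ ≫ (exists_over_hom α (F.elementsMk B b)).choose_spec.some.1)
  naturality B B' g := by
    ext b
    refine Eq.trans ?_ (a.map_baseChangeMk α f _ _ g).symm
    rw [Category.assoc]
    exact a.baseChangeMk_fst_eq α f (B := F.elementsMk B' (F.map g b)) _
      ((exists_over_hom α (F.elementsMk B b)).choose_spec.some ≫
        CategoryOfElements.homMk (F.elementsMk B b) (F.elementsMk B' (F.map g b)) g rfl)

lemma toBaseChange_app {B : F.Elements} {i : Over (F.elementsMk A α)} (k : i.left ⟶ B) :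
    (a.toBaseChange α f).app B.1 B.2 = a.baseChangeMk α f i (a.cornerFst α f i ≫ k.1) :=
  a.baseChangeMk_fst_eq α f _ k

/-- The element `α` lifts along `f` after base change. -/
lemma exists_map_eq_toBaseChange :
    ∃ z : (a.baseChange α f).obj Z, (a.baseChange α f).map f z = (a.toBaseChange α f).app A α := by
  -- The lift is the other side of the square over the identity; the square commutes.
  refine ⟨a.baseChangeMk α f (Over.mk (𝟙 _)) (a.cornerSnd α f _), ?_⟩
  refine (a.map_baseChangeMk α f _ _ f).trans (Eq.trans ?_
    (a.toBaseChange_app α f (B := F.elementsMk A α) (i := Over.mk (𝟙 _)) (𝟙 _)).symm)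
  exact congrArg (a.baseChangeMk α f (Over.mk (𝟙 _))) (a.cornerFst_comp α f _).symm

variable {α f} {J : GrothendieckTopology C} {X : C} {S : Sieve X} {x : F.obj X}

/-- Two representatives of the image of `x` agree on a finer corner, to which a covering pullback of
`S` would restrict, contradicting `h`. -/
lemma isFlatAvoiding_baseChange
    (h : ∀ (i : Over (F.elementsMk A α)) (g : i.left ⟶ F.elementsMk X x),
      S.pullback (a.cornerFst α f i ≫ g.1) ∉ J _) :
    IsFlatAvoiding J S (a.baseChange α f) ((a.toBaseChange α f).app X x) where
  isCofiltered := a.isCofiltered_elements_baseChange α f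
  notMem {Y} l y hy hJ := by
    obtain ⟨i, k, rfl⟩ := a.exists_baseChangeMk_eq α f y
    obtain ⟨j, ⟨g⟩⟩ := exists_over_hom α (F.elementsMk X x)
    rw [map_baseChangeMk] at hy
    obtain ⟨m, d, e, hde⟩ := a.exists_of_baseChangeMk_eq α f (hy.trans (a.toBaseChange_app α f g))
    apply h m (e.left ≫ g)
    have := J.pullback_stable ((a.cornerDiagram α f).map d ≫ k) hJ
    rw [← Sieve.pullback_comp, Category.assoc, hde, ← Category.assoc, cornerDiagram_map_fst,
      Category.assoc] at this
    exact this

end FunctorialCoamalgamation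

/-! ### Choosing a good member of a finite cover. -/

namespace FunctorialCoamalgamation

variable {C : Type u} [SmallCategory C] (a : FunctorialCoamalgamation C)
  {F : C ⥤ Type u} {A : C} (α : F.obj A) {J : GrothendieckTopology C} {X : C} {S : Sieve X}
  {x : F.obj X}

lemma pullback_cornerFst_mem {Z : C} {f : Z ⟶ A}
    {i j : Over (F.elementsMk A α)} (e : i ⟶ j) (g : j.left ⟶ F.elementsMk X x)
    (h : S.pullback (a.cornerFst α f j ≫ g.1) ∈ J _) :
    S.pullback (a.cornerFst α f i ≫ (e.left ≫ g).1) ∈ J _ := by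
  have := J.pullback_stable ((a.cornerDiagram α f).map e) h
  rw [← Sieve.pullback_comp, ← Category.assoc, cornerDiagram_map_fst, Category.assoc] at this
  exact this

/-- If `F` avoids `S` and the coamalgamation squares of a finite family of morphisms give covering
families, then the base change of `F` along one of these morphisms avoids `S`. -/
lemma exists_isFlatAvoiding_baseChange (hF : IsFlatAvoiding J S F x) {ι : Type*} [Finite ι]
    {U : ι → C} (f : ∀ i, U i ⟶ A)
    (hf : ∀ ⦃Y : C⦄ (h : Y ⟶ A),
      Sieve.generate (a.coamalgArrows h (Presieve.ofArrows U f)) ∈ J Y) :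
    ∃ i, ∃ _ : IsCofiltered F.Elements,
      IsFlatAvoiding J S (a.baseChange α (f i)) ((a.toBaseChange α (f i)).app X x) := by
  classical
  have := hF.isCofiltered
  suffices ∃ i, ∀ (j : Over (F.elementsMk A α)) (g : j.left ⟶ F.elementsMk X x),
      S.pullback (a.cornerFst α (f i) j ≫ g.1) ∉ J _ by
    obtain ⟨i, hi⟩ := this
    exact ⟨i, inferInstance, a.isFlatAvoiding_baseChange hi⟩
  by_contra! H
  -- Failures persist under refinement, so finitely many of them occur at a common stage.
  have key (T : Finset ι) : ∃ (j : Over (F.elementsMk A α)) (g : j.left ⟶ F.elementsMk X x),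
      ∀ i ∈ T, S.pullback (a.cornerFst α (f i) j ≫ g.1) ∈ J _ := by
    induction T using Finset.induction with
    | empty =>
      obtain ⟨j, ⟨g⟩⟩ := exists_over_hom α (F.elementsMk X x)
      exact ⟨j, g, by simp⟩
    | insert i T _ ih =>
      obtain ⟨j, g, hj⟩ := ih
      obtain ⟨j', g', hj'⟩ := H i
      obtain ⟨s, p, q, h₁, h₂⟩ := IsCofiltered.bowtie j.hom j'.hom g g'
      refine ⟨Over.mk (p ≫ j.hom), p ≫ g, fun i' hi' => ?_⟩
      obtain rfl | hi' := Finset.mem_insert.1 hi'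
      · rw [h₂]
        exact a.pullback_cornerFst_mem α (Over.homMk q h₁.symm : Over.mk (p ≫ j.hom) ⟶ j') g' hj'
      · exact a.pullback_cornerFst_mem α (Over.homMk p : Over.mk (p ≫ j.hom) ⟶ j) g (hj i' hi')
  have := Fintype.ofFinite ι
  obtain ⟨j, g, hj⟩ := key Finset.univ
  -- The corners cover `j.left.1` and `S` is covering on each, so transitivity contradicts avoidance
  -- by `F`.
  refine hF.notMem g.1 j.left.2 g.2 (J.transitive (hf j.hom.1) _ ?_)
  rintro Y _ ⟨W, k, _, ⟨_, _, ⟨i⟩⟩, rfl⟩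
  have hi : S.pullback (a.fst j.hom.1 (f i) ≫ g.1) ∈ J _ := hj i (Finset.mem_univ i)
  rw [← Sieve.pullback_comp, Category.assoc, Sieve.pullback_comp]
  exact J.pullback_stable k hi

end FunctorialCoamalgamation

/-- Finality makes the comma categories nonempty, so every arrow of `S` factors through an object of
the finite diagram. -/
lemma HasFiniteFinalSubdiagram.exists_generating {C : Type u} [Category.{v} C] {X : C}
    {S : Sieve X} (hS : HasFiniteFinalSubdiagram S) :
    ∃ (ι : Type) (_ : Finite ι) (U : ι → C) (f : ∀ i, U i ⟶ X),
      (∀ i, S (f i)) ∧ S ≤ Sieve.ofArrows U f := by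
  obtain ⟨D, _, _, i, -, -, _⟩ := hS
  refine ⟨D, inferInstance, fun d => (i.obj d).obj.left, fun d => (i.obj d).obj.hom,
    fun d => (i.obj d).property, fun Y f hf => ?_⟩
  obtain ⟨t⟩ := (Functor.Final.out (F := i) (⟨Over.mk f, hf⟩ : S.arrows.category)).is_nonempty
  exact (Sieve.mem_ofArrows_iff _ _ _).2 ⟨t.right, t.hom.hom.left, (Over.w t.hom.hom).symm⟩

/-! ### Transfinite iteration. -/

section

variable {C : Type u} [SmallCategory C] {J : GrothendieckTopology C}

/-- The element `α` of `F` belongs to the sieve `R`. -/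
def ElementMemSieve (F : C ⥤ Type u) {A : C} (R : Sieve A) (α : F.obj A) : Prop :=
  ∃ (Z : C) (f : Z ⟶ A) (_ : R f) (z : F.obj Z), F.map f z = α

lemma ElementMemSieve.map {F G : C ⥤ Type u} {A : C} {R : Sieve A} {α : F.obj A}
    (h : ElementMemSieve F R α) (p : F ⟶ G) : ElementMemSieve G R (p.app A α) := by
  obtain ⟨Z, f, hf, z, rfl⟩ := h
  exact ⟨Z, f, hf, p.app Z z, (NatTrans.naturality_apply p f z).symm⟩

/-- A flat functor avoiding `S` maps to another one in which a given element belongs to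
a given covering sieve. -/
lemma IsFlatAvoiding.exists_elementMemSieve (hco : SiteHasFunctorialCoamalgamation J)
    (hfin : ∀ (X : C) (S : Sieve X), S ∈ J X →
      ∃ S' : Sieve X, S' ≤ S ∧ S' ∈ J X ∧ HasFiniteFinalSubdiagram S')
    {X : C} {S : Sieve X} {F : C ⥤ Type u} {x : F.obj X} (hF : IsFlatAvoiding J S F x)
    {A : C} (α : F.obj A) (R : Sieve A) (hR : R ∈ J A) :
    ∃ (G : C ⥤ Type u) (p : F ⟶ G), IsFlatAvoiding J S G (p.app X x) ∧
      ElementMemSieve G R (p.app A α) := by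
  obtain ⟨a, ha⟩ := hco
  obtain ⟨R', hR', hR'J, hfinal⟩ := hfin A R hR
  obtain ⟨ι, _, U, f, hf, hle⟩ := hfinal.exists_generating
  obtain ⟨i, _, hi⟩ := a.exists_isFlatAvoiding_baseChange α hF f
    (fun Y h => ha _ (J.superset_covering hle hR'J) h)
  obtain ⟨z, hz⟩ := a.exists_map_eq_toBaseChange α (f i)
  exact ⟨_, _, hi, U i, f i, hR' _ (hf i), z, hz⟩

variable {X : C} {S : Sieve X}

open SmallObject in
/-- In a category of objects under `E₀`, if each object satisfying `P` has a morphism to an object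
satisfying `P` at which one more of the conditions `Q t` holds, and these notions are stable
under the formation of colimits of well-ordered chains, then there is an object satisfying `P` and
all conditions `Q t`. -/
lemma exists_forall_of_forall_exists_step {E : Type (u + 1)} [Category.{u} E]
    [HasColimitsOfSize.{u, u} E] (P : E → Prop) {T : Type u} (Q : T → E → Prop)
    (hQ : ∀ t {G G' : E} (_ : G ⟶ G'), Q t G → Q t G')
    (hP : ∀ (K : Type u) [LinearOrder K] [Nonempty K] {G : K ⥤ E} (c : Cocone G),
      IsColimit c → (∀ k, P (G.obj k)) → P c.pt)
    (hstep : ∀ G, P G → ∀ t, ∃ (G' : E) (_ : G ⟶ G'), P G' ∧ Q t G')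
    {G₀ : E} (h₀ : P G₀) : ∃ G, P G ∧ ∀ t, Q t G := by
  by_contra! H
  have hstep' (G : E) : ∃ (G' : E) (_ : G ⟶ G'), P G → P G' ∧ ∃ t, ¬ Q t G ∧ Q t G' := by
    by_cases hG : P G
    · obtain ⟨t, ht⟩ := H G hG
      obtain ⟨G', p, hG', hQ'⟩ := hstep G hG t
      exact ⟨G', p, fun _ => ⟨hG', t, ht, hQ'⟩⟩
    · exact ⟨G, 𝟙 G, fun h => (hG h).elim⟩
  choose succ toSucc hsucc using hstep'
  let Φ : SuccStruct E := ⟨G₀, succ, toSucc⟩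
  -- Chosen so that `κ` stages cannot inject into `T`, and infinite so that no stage is last.
  let κ : Cardinal.{u} := Order.succ (max Cardinal.aleph0 (Cardinal.mk T))
  have hκ : Cardinal.aleph0 ≤ κ := (le_max_left _ _).trans (Order.le_succ _)
  let I := κ.ord.ToType
  have hI : Cardinal.mk I = κ := by simp [I]
  have : Nonempty I := Cardinal.mk_ne_zero_iff.1 (hI ▸ (Cardinal.aleph0_pos.trans_le hκ).ne')
  let _ : OrderBot I := WellFoundedLT.toOrderBot I
  have : NoMaxOrder I := Cardinal.noMaxOrder hκ
  let Ψ := Φ.iterationFunctor I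
  have hsuccObj (j : I) : Ψ.obj (Order.succ j) = succ (Ψ.obj j) :=
    (Φ.prop_iterationFunctor_map_succ j (not_isMax j)).succ_eq.symm
  have hΨ (j : I) : P (Ψ.obj j) := by
    induction j using SuccOrder.limitRecOn with
    | isMin j hj =>
      obtain rfl := hj.eq_bot
      have : Ψ.obj ⊥ = G₀ := (Φ.iter ⊥).obj_bot
      rwa [this]
    | succ j _ ih =>
      rw [hsuccObj]
      exact (hsucc _ ih).1
    | isSuccLimit j hj ih =>
      have : Nonempty (Set.Iio j) := ⟨⟨⊥, hj.bot_lt⟩⟩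
      exact hP (Set.Iio j) _ (Ψ.isColimitOfIsWellOrderContinuous j hj) fun k => ih k.1 k.2
  -- `t j` fails at stage `j` and holds from the next stage on, hence `t` is injective.
  choose t ht ht' using fun j => (hsucc _ (hΨ j)).2
  have ht'' {i j : I} (hij : i < j) : t i ≠ t j := fun h => ht j (by
    rw [← h]
    refine hQ _ (Ψ.map (homOfLE (Order.succ_le_of_lt hij))) ?_
    rw [hsuccObj]
    exact ht' i)
  have hinj : Function.Injective t := fun i j hij => by
    by_contra hne
    obtain h | h := lt_or_gt_of_ne hne
    exacts [ht'' h hij, ht'' h hij.symm]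
  have hle := Cardinal.mk_le_of_injective hinj
  rw [hI] at hle
  exact (hle.trans (le_max_right _ _)).not_gt (Order.lt_succ _)

/-- A flat functor avoiding `S` maps to another one in which all its elements belong to
all covering sieves. -/
lemma IsFlatAvoiding.exists_forall_elementMemSieve (hco : SiteHasFunctorialCoamalgamation J)
    (hfin : ∀ (X : C) (S : Sieve X), S ∈ J X →
      ∃ S' : Sieve X, S' ≤ S ∧ S' ∈ J X ∧ HasFiniteFinalSubdiagram S')
    {F : C ⥤ Type u} {x : F.obj X} (hF : IsFlatAvoiding J S F x) :
    ∃ (G : C ⥤ Type u) (p : F ⟶ G), IsFlatAvoiding J S G (p.app X x) ∧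
      ∀ {A : C} (α : F.obj A) (R : Sieve A), R ∈ J A → ElementMemSieve G R (p.app A α) := by
  let hom (G : Under F) : F ⟶ G.right := G.hom
  have hom_comp {G G' : Under F} (q : G ⟶ G') {A : C} (α : F.obj A) :
      q.right.app A ((hom G).app A α) = (hom G').app A α :=
    ConcreteCategory.congr_hom (NatTrans.congr_app (Under.w q) A) α
  obtain ⟨G, hG, hG'⟩ := exists_forall_of_forall_exists_step (E := Under F)
    (fun G => IsFlatAvoiding J S G.right ((hom G).app X x))
    (T := Σ A : C, F.obj A × { R : Sieve A // R ∈ J A })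
    (fun t G => ElementMemSieve G.right t.2.2.1 ((hom G).app t.1 t.2.1))
    (fun t G G' q h => by
      have := h.map q.right
      rwa [hom_comp] at this)
    -- A nonempty chain is connected, so its colimit under `F` is computed in functors.
    (fun K _ _ G c hc h => .of_isColimit (isColimitOfPreserves (Under.forget F) hc)
      (x := fun k => (hom (G.obj k)).app X x) (fun e => hom_comp (G.map e) x)
      (fun k => hom_comp (c.ι.app k) x) h)
    (fun G hG t => by
      obtain ⟨G', p, hG', hm⟩ := hG.exists_elementMemSieve hco hfin ((hom G).app t.1 t.2.1)
        t.2.2.1 t.2.2.2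
      exact ⟨Under.mk (hom G ≫ p), Under.homMk p, hG', hm⟩)
    (G₀ := Under.mk (𝟙 F)) hF
  exact ⟨G.right, hom G, hG, fun α R hR => hG' ⟨_, α, R, hR⟩⟩

/-- If the sieve `S` is not covering, some flat functor avoiding `S` sends covering sieves to
jointly surjective families. -/
lemma exists_isFlatAvoiding_forall_elementMemSieve (hco : SiteHasFunctorialCoamalgamation J)
    (hfin : ∀ (X : C) (S : Sieve X), S ∈ J X →
      ∃ S' : Sieve X, S' ≤ S ∧ S' ∈ J X ∧ HasFiniteFinalSubdiagram S')
    (hS : S ∉ J X) :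
    ∃ (F : C ⥤ Type u) (x : F.obj X), IsFlatAvoiding J S F x ∧
      ∀ {A : C} (α : F.obj A) (R : Sieve A), R ∈ J A → ElementMemSieve F R α := by
  let T := { q : Σ F : C ⥤ Type u, F.obj X // IsFlatAvoiding J S q.1 q.2 }
  choose next map hnext hmem using fun q : T => q.2.exists_forall_elementMemSieve hco hfin
  -- Each `next` treats only the elements already present, hence the ω-fold repetition.
  let s (n : ℕ) : T := n.rec ⟨⟨_, _⟩, .coyoneda hS⟩ fun _ q => ⟨⟨_, _⟩, hnext q⟩
  let G : ℕ ⥤ C ⥤ Type u := Functor.ofSequence (X := fun n => (s n).1.1) fun n => map (s n)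
  have hG (n : ℕ) : G.map (homOfLE n.le_succ) = map (s n) := Functor.ofSequence_map_homOfLE_succ _ n
  have hx {k l : ℕ} (e : k ⟶ l) : (G.map e).app X (s k).1.2 = (s l).1.2 := by
    obtain ⟨m, rfl⟩ := Nat.exists_eq_add_of_le (leOfHom e)
    induction m with
    | zero =>
      obtain rfl : e = 𝟙 _ := Subsingleton.elim _ _
      rw [G.map_id]
      rfl
    | succ m ih =>
      obtain rfl : e = homOfLE (Nat.le_add_right k m) ≫ homOfLE (Nat.le_succ (k + m)) :=
        Subsingleton.elim _ _
      rw [G.map_comp, hG]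
      exact congrArg ((map (s (k + m))).app X) (ih (homOfLE (Nat.le_add_right k m)))
  have hx' (k : ℕ) : (colimit.ι G k).app X (s k).1.2 = (colimit.ι G 0).app X (s 0).1.2 := by
    rw [← hx (homOfLE k.zero_le)]
    exact FunctorToTypes.colimit_ι_map_apply (colimit.cocone G) _ _
  refine ⟨colimit G, _, .of_isColimit (colimit.isColimit G) hx hx' fun k => (s k).2,
    fun {A} α R hR => ?_⟩
  obtain ⟨n, α, rfl⟩ := FunctorToTypes.colimit_exists_rep (colimit.isColimit G) α
  have := (hmem (s n) α R hR).map (colimit.ι G (n + 1))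
  rw [← hG] at this
  rwa [← FunctorToTypes.colimit_ι_map_apply (colimit.cocone G) (homOfLE n.le_succ) α]

end

/-! ### Conservativity of the points. -/

theorem corollary4p8 {C : Type u} [SmallCategory.{u} C] (J : GrothendieckTopology C)
    (hco : SiteHasFunctorialCoamalgamation J)
    (hfin : ∀ (X : C) (S : Sieve X), S ∈ J X →
      ∃ S' : Sieve X, S' ≤ S ∧ S' ∈ J X ∧ HasFiniteFinalSubdiagram S') :
    ToposHasEnoughPoints.{u} (Sheaf J (Type u)) := by
  choose F x hF hmem using fun q : { q : Σ X : C, Sieve X // q.2 ∉ J q.1 } =>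
    exists_isFlatAvoiding_forall_elementMemSieve hco hfin q.2
  let pt (q : { q : Σ X : C, Sieve X // q.2 ∉ J q.1 }) : J.Point :=
    { fiber := F q
      isCofiltered := (hF q).isCofiltered
      initiallySmall := initiallySmall_of_essentiallySmall _
      jointly_surjective := fun R hR α => hmem q α R hR }
  have hpt : (ObjectProperty.ofObj pt).IsConservativeFamilyOfPoints := by
    refine .mk' fun X S hS => ?_
    by_contra hSJ
    -- At the point built for `S`, surjectivity would lift `x` along some `g` in `S`, where the
    -- pullback of `S` is maximal.
    obtain ⟨Y, g, hg, y, hy⟩ := hS ⟨pt ⟨⟨X, S⟩, hSJ⟩, ⟨_⟩⟩ (x ⟨⟨X, S⟩, hSJ⟩)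
    refine (hF ⟨⟨X, S⟩, hSJ⟩).notMem g y hy ?_
    rw [Sieve.pullback_eq_top_of_mem S hg]
    exact J.top_mem _
  refine ⟨_, fun q => ⟨_, _, (pt q).skyscraperSheafAdjunction, inferInstance⟩,
    ⟨fun {M N} f hf => ?_⟩⟩
  have (Φ : (ObjectProperty.ofObj pt).FullSubcategory) :
      IsIso ((Φ.obj.sheafFiber (A := Type u)).map f) := by
    obtain ⟨_, ⟨q⟩⟩ := Φ
    exact hf q
  exact hpt.jointlyReflectIsomorphisms_type.isIso f
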